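/- Let $p$ be a prime, $\Bbbk$ a field of characteristic $p$ and $n\in\mathbb{N}=\{0,1,2,\dots\}$. Let $\mathrm{NH}_n$ be the nilHecke algebra over $\Bbbk$: the $\Bbbk$-algebra with generators $x_1,\dots,x_n$, $\delta_1,\dots,\delta_{n-1}$ and relations $\delta_i^2=0$, $\delta_i\delta_{i+1}\delta_i=\delta_{i+1}\delta_i\delta_{i+1}$, $\delta_i\delta_j=\delta_j\delta_i$ for $|i-j|>1$, $x_ix_j=x_jx_i$, $x_i\delta_j=\delta_jx_i$ for $i\notin\{j,j+1\}$, $x_i\delta_i-\delta_ix_{i+1}=1$ and $\delta_ix_i-x_{i+1}\delta_i=1$ (so $\mathrm{NH}_0=\Bbbk$), graded by $\deg x_i=2$, $\deg\delta_i=-2$. Let $\partial_0$ be the $\Bbbk$-linear derivation of $\mathrm{NH}_n$ with $\partial_0(x_i)=x_i^2$ and $\partial_0(\delta_i)=-x_i\delta_i-x_{i+1}\delta_i$; it has degree $2$ and satisfies $\partial_0^p=0$, so that $(\mathrm{NH}_n,\partial_0)$ is a $p$-DG algebra. A (left) $p$-DG module $M$ over a $p$-DG algebra $(A,\partial)$ is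 a $\mathbb{Z}$-graded left $A$-module with a $\Bbbk$-linear endomorphism $\partial_M$ of degree $2$ with $\partial_M^p=0$ and $\partial_M(am)=\partial(a)m+a\,\partial_M(m)$; morphisms are the $A$-linear maps of degree $0$ commuting with the differentials. Two morphisms $f,g:M\to N$ are homotopic if $f-g=\sum_{i=0}^{p-1}\partial_N^{p-1-i}\circ h\circ\partial_M^{i}$ for some $A$-linear map $h:M\to N$ of degree $2-2p$. The homotopy category $\mathcal{C}(A,\partial)$ is the quotient of the category of $p$-DG modules by homotopy. A morphism is a quasi-isomorphism if it induces an isomorphism of the underlying $p$-complexes of $\Bbbk$-vector spaces up to homotopy (with $\Bbbk$-linear $h$), and the derived category $\mathcal{D}(A,\partial)$ is the localization of $\mathcal{C}(A,\partial)$ at the quasi-isomorphisms. Then for every $n\in\mathbb{N}$ the derived category $\mathcal{D}(\mathrm{NH}_n,\partial_0)$ is nonzero, i.e. it is not equivalent to the zero category (the category with one object and one morphism). -/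

import Mathlib

open CategoryTheory

universe u

set_option linter.unusedSimpArgs false

/-! ### `p`-complexes -/

/-- A `p`-complex over `k`: a `ℤ`-graded `k`-vector space with a `k`-linear endomorphism `d` of
degree `2` such that `d ^ p = 0`. Equivalently, a graded module over `k[d]/(d ^ p)`, `deg d = 2`. -/
structure PComplex (k : Type u) [Field k] (p : ℕ) where
  carrier : Type u
  [addCommGroup : AddCommGroup carrier]
  [module : Module k carrier]
  /-- the homogeneous components -/
  grading : ℤ → Submodule k carrier
  isInternal : DirectSum.IsInternal grading
  /-- the differential -/
  d : Module.End k carrier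
  d_mem : ∀ (i : ℤ) (m : carrier), m ∈ grading i → d m ∈ grading (i + 2)
  d_pow : d ^ p = 0

namespace PComplex

variable {k : Type u} [Field k] {p : ℕ}

instance (M : PComplex k p) : AddCommGroup M.carrier := M.addCommGroup

instance (M : PComplex k p) : Module k M.carrier := M.module

/-- Morphisms of `p`-complexes: `k`-linear maps of degree `0` commuting with the differentials. -/
@[ext]
structure Hom (M N : PComplex k p) where
  toLinearMap : M.carrier →ₗ[k] N.carrier
  map_mem : ∀ (i : ℤ) (m : M.carrier), m ∈ M.grading i → toLinearMap m ∈ N.grading i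
  map_d : ∀ m : M.carrier, toLinearMap (M.d m) = N.d (toLinearMap m)

/-- The category of `p`-complexes. -/
instance : Category (PComplex k p) where
  Hom M N := Hom M N
  id M := ⟨LinearMap.id, fun _ _ h => h, fun _ => rfl⟩
  comp f g := ⟨g.toLinearMap ∘ₗ f.toLinearMap, fun i m h => g.map_mem i _ (f.map_mem i m h),
    fun m => by simp [f.map_d, g.map_d]⟩

/-- Two morphisms of `p`-complexes are homotopic if
`f - g = ∑_{i = 0}^{p - 1} d ^ (p - 1 - i) ∘ h ∘ d ^ i` for a `k`-linear map `h` of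
degree `2 - 2p`. -/
def Homotopic : HomRel (PComplex k p) := fun M N f g =>
  ∃ h : M.carrier →ₗ[k] N.carrier,
    (∀ (i : ℤ) (m : M.carrier), m ∈ M.grading i → h m ∈ N.grading (i + (2 - 2 * (p : ℤ)))) ∧
    ∀ m : M.carrier, f.toLinearMap m - g.toLinearMap m =
      ∑ i ∈ Finset.range p, (N.d ^ (p - 1 - i)) (h ((M.d ^ i) m))

/-- The homotopy category of `p`-complexes (the stable category of graded
`k[d]/(d ^ p)`-modules). -/
abbrev HomotopyCat (k : Type u) [Field k] (p : ℕ) := CategoryTheory.Quotient (Homotopic (k := k) (p := p))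

end PComplex

/-! ### `p`-DG algebras, `p`-DG modules and the derived category -/

/-- The structure of a `p`-DG algebra on a `k`-algebra `A`: a `ℤ`-grading and a `k`-linear
derivation `d` of degree `2` such that `d ^ p = 0`. -/
structure PDGAlgebra (k : Type u) [Field k] (p : ℕ) (A : Type u) [Ring A] [Algebra k A] where
  grading : ℤ → Submodule k A
  isInternal : DirectSum.IsInternal grading
  one_mem : (1 : A) ∈ grading 0
  mul_mem : ∀ (i j : ℤ) (a b : A), a ∈ grading i → b ∈ grading j → a * b ∈ grading (i + j)
  /-- the differential -/
  d : Module.End k A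
  d_mem : ∀ (i : ℤ) (a : A), a ∈ grading i → d a ∈ grading (i + 2)
  d_pow : d ^ p = 0
  leibniz : ∀ a b : A, d (a * b) = d a * b + a * d b

/-- A left `p`-DG module over a `p`-DG algebra `𝒜` with underlying algebra `A`: a graded left
`A`-module which is a `p`-complex, such that `d (a m) = d a m + a d m`. -/
structure PDGModule {k : Type u} [Field k] {p : ℕ} {A : Type u} [Ring A] [Algebra k A]
    (𝒜 : PDGAlgebra k p A) extends PComplex k p where
  [moduleA : Module A carrier]
  [isScalarTower : IsScalarTower k A carrier]
  smul_mem : ∀ (i j : ℤ) (a : A) (m : carrier),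
    a ∈ 𝒜.grading i → m ∈ grading j → a • m ∈ grading (i + j)
  leibniz : ∀ (a : A) (m : carrier), d (a • m) = 𝒜.d a • m + a • d m

namespace PDGModule

variable {k : Type u} [Field k] {p : ℕ} {A : Type u} [Ring A] [Algebra k A]
  {𝒜 : PDGAlgebra k p A}

instance (M : PDGModule 𝒜) : Module A M.carrier := M.moduleA

instance (M : PDGModule 𝒜) : IsScalarTower k A M.carrier := M.isScalarTower

/-- Morphisms of `p`-DG modules: `A`-linear maps of degree `0` commuting with the
differentials. -/
@[ext]
structure Hom (M N : PDGModule 𝒜) where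
  toLinearMap : M.carrier →ₗ[A] N.carrier
  map_mem : ∀ (i : ℤ) (m : M.carrier), m ∈ M.grading i → toLinearMap m ∈ N.grading i
  map_d : ∀ m : M.carrier, toLinearMap (M.d m) = N.d (toLinearMap m)

/-- The category of left `p`-DG modules. -/
instance : Category (PDGModule 𝒜) where
  Hom M N := Hom M N
  id M := ⟨LinearMap.id, fun _ _ h => h, fun _ => rfl⟩
  comp f g := ⟨g.toLinearMap ∘ₗ f.toLinearMap, fun i m h => g.map_mem i _ (f.map_mem i m h),
    fun m => by simp [f.map_d, g.map_d]⟩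

/-- Two morphisms of `p`-DG modules are homotopic if
`f - g = ∑_{i = 0}^{p - 1} d ^ (p - 1 - i) ∘ h ∘ d ^ i` for an `A`-linear map `h` of
degree `2 - 2p`. -/
def Homotopic : HomRel (PDGModule 𝒜) := fun M N f g =>
  ∃ h : M.carrier →ₗ[A] N.carrier,
    (∀ (i : ℤ) (m : M.carrier), m ∈ M.grading i → h m ∈ N.grading (i + (2 - 2 * (p : ℤ)))) ∧
    ∀ m : M.carrier, f.toLinearMap m - g.toLinearMap m =
      ∑ i ∈ Finset.range p, (N.d ^ (p - 1 - i)) (h ((M.d ^ i) m))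

/-- The homotopy category of `p`-DG modules over `𝒜`. -/
abbrev HomotopyCat (𝒜 : PDGAlgebra k p A) := CategoryTheory.Quotient (Homotopic (𝒜 := 𝒜))

/-- The functor sending a `p`-DG module to its underlying `p`-complex. -/
def forget (𝒜 : PDGAlgebra k p A) : PDGModule 𝒜 ⥤ PComplex k p where
  obj M := M.toPComplex
  map f := ⟨f.toLinearMap.restrictScalars k, f.map_mem, f.map_d⟩

/-- The functor induced by `forget` on homotopy categories. -/
def homotopyForget (𝒜 : PDGAlgebra k p A) : HomotopyCat 𝒜 ⥤ PComplex.HomotopyCat k p :=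
  CategoryTheory.Quotient.lift _ (forget 𝒜 ⋙ CategoryTheory.Quotient.functor _) (by
    rintro M N f g ⟨h, hdeg, hh⟩
    exact CategoryTheory.Quotient.sound _ ⟨h.restrictScalars k, hdeg, hh⟩)

/-- Quasi-isomorphisms: the morphisms which induce an isomorphism of the underlying
`p`-complexes up to homotopy. -/
def quasiIso (𝒜 : PDGAlgebra k p A) : MorphismProperty (HomotopyCat 𝒜) :=
  (MorphismProperty.isomorphisms (PComplex.HomotopyCat k p)).inverseImage (homotopyForget 𝒜)

end PDGModule

/-- The derived category of a `p`-DG algebra: the localization of the homotopy category of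
`p`-DG modules at the quasi-isomorphisms. -/
abbrev PDGDerivedCategory {k : Type u} [Field k] {p : ℕ} {A : Type u} [Ring A] [Algebra k A]
    (𝒜 : PDGAlgebra k p A) :=
  (PDGModule.quasiIso 𝒜).Localization

/-! ### The nilHecke algebra -/

/-- The generators `x_i` (`0 ≤ i < n`) and `δ_i` (`0 ≤ i < n - 1`) of the nilHecke algebra on
`n` strands, indexed from `0`. -/
inductive NilHeckeGen (n : ℕ) : Type
  | x (i : ℕ) (hi : i < n) : NilHeckeGen n
  | δ (i : ℕ) (hi : i + 1 < n) : NilHeckeGen n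

/-- The degrees of the generators. -/
def NilHeckeGen.deg {n : ℕ} : NilHeckeGen n → ℤ
  | x _ _ => 2
  | δ _ _ => -2

section Relations

variable (k : Type u) [Field k] {n : ℕ}

/-- The generator `x_i` in the free algebra. -/
abbrev freeX (i : ℕ) (hi : i < n) : FreeAlgebra k (NilHeckeGen n) :=
  FreeAlgebra.ι k (NilHeckeGen.x i hi)

/-- The generator `δ_i` in the free algebra. -/
abbrev freeδ (i : ℕ) (hi : i + 1 < n) : FreeAlgebra k (NilHeckeGen n) :=
  FreeAlgebra.ι k (NilHeckeGen.δ i hi)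

/-- The defining relations of the nilHecke algebra. -/
inductive NilHeckeRel : FreeAlgebra k (NilHeckeGen n) → FreeAlgebra k (NilHeckeGen n) → Prop
  | δ_sq (i : ℕ) (hi : i + 1 < n) : NilHeckeRel (freeδ k i hi * freeδ k i hi) 0
  | braid (i : ℕ) (hi : i + 1 < n) (hi' : i + 1 + 1 < n) :
      NilHeckeRel (freeδ k i hi * freeδ k (i + 1) hi' * freeδ k i hi)
        (freeδ k (i + 1) hi' * freeδ k i hi * freeδ k (i + 1) hi')
  | δ_comm (i j : ℕ) (hi : i + 1 < n) (hj : j + 1 < n) (hij : i + 1 < j ∨ j + 1 < i) :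
      NilHeckeRel (freeδ k i hi * freeδ k j hj) (freeδ k j hj * freeδ k i hi)
  | x_δ_comm (i j : ℕ) (hi : i < n) (hj : j + 1 < n) (h : j ≠ i) (h' : j + 1 ≠ i) :
      NilHeckeRel (freeX k i hi * freeδ k j hj) (freeδ k j hj * freeX k i hi)
  | x_comm (i j : ℕ) (hi : i < n) (hj : j < n) :
      NilHeckeRel (freeX k i hi * freeX k j hj) (freeX k j hj * freeX k i hi)
  | x_δ (i : ℕ) (hi : i < n) (hi' : i + 1 < n) :
      NilHeckeRel (freeX k i hi * freeδ k i hi' - freeδ k i hi' * freeX k (i + 1) hi') 1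
  | δ_x (i : ℕ) (hi : i < n) (hi' : i + 1 < n) :
      NilHeckeRel (freeδ k i hi' * freeX k i hi - freeX k (i + 1) hi' * freeδ k i hi') 1

end Relations

/-- The nilHecke algebra `NH_n` over `k`. -/
abbrev NilHecke (k : Type u) [Field k] (n : ℕ) : Type u :=
  RingQuot (NilHeckeRel k (n := n))

namespace NilHecke

variable (k : Type u) [Field k] (n : ℕ)

/-- The image of a generator in the nilHecke algebra. -/
def gen (g : NilHeckeGen n) : NilHecke k n :=
  RingQuot.mkAlgHom k (NilHeckeRel k) (FreeAlgebra.ι k g)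

variable {n}

/-- The generator `x_i`. -/
abbrev X (i : ℕ) (hi : i < n) : NilHecke k n := gen k n (.x i hi)

/-- The generator `δ_i`. -/
abbrev δ (i : ℕ) (hi : i + 1 < n) : NilHecke k n := gen k n (.δ i hi)

lemma δ_sq (i : ℕ) (hi : i + 1 < n) : δ k i hi * δ k i hi = 0 := by
  simpa [gen] using RingQuot.mkAlgHom_rel k (NilHeckeRel.δ_sq (k := k) i hi)

lemma braid (i : ℕ) (hi : i + 1 < n) (hi' : i + 1 + 1 < n) :
    δ k i hi * δ k (i + 1) hi' * δ k i hi = δ k (i + 1) hi' * δ k i hi * δ k (i + 1) hi' := by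
  simpa [gen] using RingQuot.mkAlgHom_rel k (NilHeckeRel.braid (k := k) i hi hi')

lemma δ_comm (i j : ℕ) (hi : i + 1 < n) (hj : j + 1 < n) (hij : i + 1 < j ∨ j + 1 < i) :
    δ k i hi * δ k j hj = δ k j hj * δ k i hi := by
  simpa [gen] using RingQuot.mkAlgHom_rel k (NilHeckeRel.δ_comm (k := k) i j hi hj hij)

lemma x_δ_comm (i j : ℕ) (hi : i < n) (hj : j + 1 < n) (h : j ≠ i) (h' : j + 1 ≠ i) :
    X k i hi * δ k j hj = δ k j hj * X k i hi := by
  simpa [gen] using RingQuot.mkAlgHom_rel k (NilHeckeRel.x_δ_comm (k := k) i j hi hj h h')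

lemma x_comm (i j : ℕ) (hi : i < n) (hj : j < n) :
    X k i hi * X k j hj = X k j hj * X k i hi := by
  simpa [gen] using RingQuot.mkAlgHom_rel k (NilHeckeRel.x_comm (k := k) i j hi hj)

lemma x_δ (i : ℕ) (hi : i < n) (hi' : i + 1 < n) :
    X k i hi * δ k i hi' - δ k i hi' * X k (i + 1) hi' = 1 := by
  simpa [gen] using RingQuot.mkAlgHom_rel k (NilHeckeRel.x_δ (k := k) i hi hi')

lemma δ_x (i : ℕ) (hi : i < n) (hi' : i + 1 < n) :
    δ k i hi' * X k i hi - X k (i + 1) hi' * δ k i hi' = 1 := by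
  simpa [gen] using RingQuot.mkAlgHom_rel k (NilHeckeRel.δ_x (k := k) i hi hi')

/-- An algebra homomorphism out of the nilHecke algebra. -/
noncomputable def lift {B : Type u} [Ring B] [Algebra k B] (f : NilHeckeGen n → B)
    (hf : ∀ ⦃a b : FreeAlgebra k (NilHeckeGen n)⦄, NilHeckeRel k a b →
      FreeAlgebra.lift k f a = FreeAlgebra.lift k f b) : NilHecke k n →ₐ[k] B :=
  RingQuot.liftAlgHom k ⟨FreeAlgebra.lift k f, hf⟩

lemma lift_gen {B : Type u} [Ring B] [Algebra k B] (f : NilHeckeGen n → B)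
    (hf : ∀ ⦃a b : FreeAlgebra k (NilHeckeGen n)⦄, NilHeckeRel k a b →
      FreeAlgebra.lift k f a = FreeAlgebra.lift k f b) (g : NilHeckeGen n) :
    lift k f hf (gen k n g) = f g := by
  simp [lift, gen]

lemma induction {P : NilHecke k n → Prop} (hsc : ∀ r : k, P (algebraMap k _ r))
    (hgen : ∀ g, P (gen k n g)) (hadd : ∀ a b, P a → P b → P (a + b))
    (hmul : ∀ a b, P a → P b → P (a * b)) (a : NilHecke k n) : P a := by
  obtain ⟨a, rfl⟩ := RingQuot.mkAlgHom_surjective k (NilHeckeRel k) a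
  induction a using FreeAlgebra.induction with
  | grade0 r => simpa using hsc r
  | grade1 x => exact hgen x
  | mul a b ha hb => simpa using hmul _ _ ha hb
  | add a b ha hb => simpa using hadd _ _ ha hb

/-- The values of the differential `∂_a` on the generators:
`∂_a x_i = x_i ^ 2` and `∂_a δ_i = a - (a + 1) x_i δ_i + (a - 1) x_{i + 1} δ_i`. -/
noncomputable def dGen (a : k) : NilHeckeGen n → NilHecke k n
  | .x i hi => X k i hi ^ 2
  | .δ i hi => algebraMap k _ a - (a + 1) • (X k i (by omega) * δ k i hi)
      + (a - 1) • (X k (i + 1) hi * δ k i hi)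

/-- The differential `∂_a` is compatible with the braid relation. -/
lemma braid_aux {R : Type u} [Ring R] [Algebra k R] (a : k) (s t x y z : R)
    (ss : s * s = 0) (tt : t * t = 0) (st : s * t * s = t * s * t)
    (sz : s * z = z * s) (tx : t * x = x * t) (sx : s * x = y * s + 1)
    (sy : s * y = x * s - 1) (ty : t * y = z * t + 1) (tz : t * z = y * t - 1) :
    s * t * (algebraMap k R a - (a + 1) • (x * s) + (a - 1) • (y * s)) +
    (s * (algebraMap k R a - (a + 1) • (y * t) + (a - 1) • (z * t)) +
      (algebraMap k R a - (a + 1) • (x * s) + (a - 1) • (y * s)) * t) * s =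
    t * s * (algebraMap k R a - (a + 1) • (y * t) + (a - 1) • (z * t)) +
    (t * (algebraMap k R a - (a + 1) • (x * s) + (a - 1) • (y * s)) +
      (algebraMap k R a - (a + 1) • (y * t) + (a - 1) • (z * t)) * s) * t := by
  have h' : ∀ {u v w : R}, u * v = w → ∀ c, u * (v * c) = w * c := by
    rintro u v w rfl c; rw [mul_assoc]
  rw [mul_assoc, mul_assoc] at st
  simp only [Algebra.algebraMap_eq_smul_one, mul_add, add_mul, mul_sub, sub_mul, smul_mul_assoc,
    mul_smul_comm, mul_assoc, ss, tt, ← st, sz, h' sz, tx, h' tx, sx, h' sx,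
    sy, h' sy, ty, h' ty, tz, h' tz, zero_mul, mul_zero, one_mul, mul_one, smul_zero, smul_add,
    smul_sub]
  module

lemma δ_mul_x (i : ℕ) (hi : i < n) (hi' : i + 1 < n) :
    δ k i hi' * X k i hi = X k (i + 1) hi' * δ k i hi' + 1 := by
  rw [← δ_x k i hi hi']; abel

lemma δ_mul_x' (i : ℕ) (hi : i < n) (hi' : i + 1 < n) :
    δ k i hi' * X k (i + 1) hi' = X k i hi * δ k i hi' - 1 := by
  rw [← x_δ k i hi hi']; abel

lemma mul_mul_of_eq {R : Type u} [Ring R] {u v w : R} (h : u * v = w) (c : R) :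
    u * (v * c) = w * c := by
  rw [← h, mul_assoc]

/-- The values on generators of the homomorphism `b ↦ b + ε ∂_a b` to the dual numbers. -/
noncomputable def dualGen (a : k) (g : NilHeckeGen n) : DualNumber (NilHecke k n) :=
  (gen k n g, dGen k a g)

lemma dualGen_rel (a : k) ⦃b c : FreeAlgebra k (NilHeckeGen n)⦄ (h : NilHeckeRel k b c) :
    FreeAlgebra.lift k (dualGen k a) b = FreeAlgebra.lift k (dualGen k a) c := by
  have hf : ∀ g, (dualGen k a g : DualNumber (NilHecke k n)).fst = gen k n g := fun _ => rfl
  have hs : ∀ g, (dualGen k a g : DualNumber (NilHecke k n)).snd = dGen k a g := fun _ => rfl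
  cases h with
  | δ_sq i hi =>
    ext
    · simpa [hf] using δ_sq k i hi
    · have h1 := δ_sq k i hi
      have h2 := δ_mul_x k i (by omega) hi
      have h3 := δ_mul_x' k i (by omega) hi
      simp only [map_mul, FreeAlgebra.lift_ι_apply, TrivSqZeroExt.snd_mul, hf, hs, dGen, map_zero,
        TrivSqZeroExt.snd_zero, smul_eq_mul, op_smul_eq_mul,
        Algebra.algebraMap_eq_smul_one, mul_add, add_mul, mul_sub, sub_mul, smul_mul_assoc,
        mul_smul_comm, mul_assoc, h1, mul_mul_of_eq h2, mul_mul_of_eq h3, mul_zero, mul_one,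
        one_mul]
      module
  | braid i hi hi' =>
    ext
    · simpa [hf] using braid k i hi hi'
    · have := braid_aux k a (δ k i hi) (δ k (i + 1) hi') (X k i (by omega)) (X k (i + 1) hi)
        (X k (i + 1 + 1) hi') (δ_sq k _ _) (δ_sq k _ _) (braid k _ _ _)
        (x_δ_comm k _ _ _ _ (by omega) (by omega)).symm
        (x_δ_comm k _ _ _ _ (by omega) (by omega)).symm (δ_mul_x k _ _ _) (δ_mul_x' k _ _ _)
        (δ_mul_x k _ _ _) (δ_mul_x' k _ _ _)
      simp only [map_mul, FreeAlgebra.lift_ι_apply, TrivSqZeroExt.snd_mul, TrivSqZeroExt.fst_mul,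
        hf, hs, dGen, smul_eq_mul, op_smul_eq_mul]
      exact this
  | δ_comm i j hi hj hij =>
    ext
    · simpa [hf] using δ_comm k i j hi hj hij
    · have h1 := δ_comm k j i hj hi hij.symm
      have h2 := x_δ_comm k i j (by omega) hj (by omega) (by omega)
      have h3 := x_δ_comm k (i + 1) j hi hj (by omega) (by omega)
      have h4 := x_δ_comm k j i (by omega) hi (by omega) (by omega)
      have h5 := x_δ_comm k (j + 1) i hj hi (by omega) (by omega)
      simp only [map_mul, FreeAlgebra.lift_ι_apply, TrivSqZeroExt.snd_mul, hf, hs, dGen,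
        smul_eq_mul, op_smul_eq_mul,
        Algebra.algebraMap_eq_smul_one, mul_add, add_mul, mul_sub, sub_mul, smul_mul_assoc,
        mul_smul_comm, mul_assoc, h1, mul_mul_of_eq h2.symm, mul_mul_of_eq h3.symm,
        mul_mul_of_eq h4.symm, mul_mul_of_eq h5.symm, mul_one, one_mul]
      module
  | x_δ_comm i j hi hj h h' =>
    ext
    · simpa [hf] using x_δ_comm k i j hi hj h h'
    · have h1 := x_δ_comm k i j hi hj h h'
      have h2 := x_comm k j i (by omega) hi
      have h3 := x_comm k (j + 1) i hj hi
      simp only [map_mul, FreeAlgebra.lift_ι_apply, TrivSqZeroExt.snd_mul, hf, hs, dGen,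
        smul_eq_mul, op_smul_eq_mul, pow_two,
        Algebra.algebraMap_eq_smul_one, mul_add, add_mul, mul_sub, sub_mul, smul_mul_assoc,
        mul_smul_comm, mul_assoc, h1.symm, mul_mul_of_eq h1.symm, mul_mul_of_eq h2,
        mul_mul_of_eq h3, mul_one, one_mul]
      module
  | x_comm i j hi hj =>
    ext
    · simpa [hf] using x_comm k i j hi hj
    · have h1 : Commute (X k i hi) (X k j hj) := x_comm k i j hi hj
      have h2 := (h1.pow_right 2).eq
      have h3 := (h1.pow_left 2).eq
      simp only [map_mul, FreeAlgebra.lift_ι_apply, TrivSqZeroExt.snd_mul, hf, hs, dGen,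
        smul_eq_mul, op_smul_eq_mul, h2, h3]
      abel
  | x_δ i hi hi' =>
    ext
    · simpa [hf] using x_δ k i hi hi'
    · have h1 := δ_mul_x k i hi hi'
      have h2 := δ_mul_x' k i hi hi'
      have h3 := x_comm k (i + 1) i hi' hi
      simp only [map_mul, map_sub, map_one, FreeAlgebra.lift_ι_apply, TrivSqZeroExt.snd_mul,
        TrivSqZeroExt.snd_sub, TrivSqZeroExt.snd_one, hf, hs, dGen,
        smul_eq_mul, op_smul_eq_mul, pow_two,
        Algebra.algebraMap_eq_smul_one, mul_add, add_mul, mul_sub, sub_mul, smul_mul_assoc,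
        mul_smul_comm, mul_assoc, h1, mul_mul_of_eq h1, h2, mul_mul_of_eq h2, h3,
        mul_mul_of_eq h3, mul_one, one_mul]
      module
  | δ_x i hi hi' =>
    ext
    · simpa [hf] using δ_x k i hi hi'
    · have h1 := δ_mul_x k i hi hi'
      have h2 := δ_mul_x' k i hi hi'
      have h3 := x_comm k (i + 1) i hi' hi
      simp only [map_mul, map_sub, map_one, FreeAlgebra.lift_ι_apply, TrivSqZeroExt.snd_mul,
        TrivSqZeroExt.snd_sub, TrivSqZeroExt.snd_one, hf, hs, dGen,
        smul_eq_mul, op_smul_eq_mul, pow_two,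
        Algebra.algebraMap_eq_smul_one, mul_add, add_mul, mul_sub, sub_mul, smul_mul_assoc,
        mul_smul_comm, mul_assoc, h1, mul_mul_of_eq h1, h2, mul_mul_of_eq h2, h3,
        mul_mul_of_eq h3, mul_one, one_mul]
      module

/-- The homomorphism `b ↦ b + ε ∂_a b` to the dual numbers. -/
noncomputable def dualHom (a : k) : NilHecke k n →ₐ[k] DualNumber (NilHecke k n) :=
  lift k (dualGen k a) (dualGen_rel k a)

lemma dualHom_fst (a : k) (b : NilHecke k n) : (dualHom k a b).fst = b := by
  induction b using NilHecke.induction with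
  | hsc r => rw [AlgHom.commutes]; rfl
  | hgen g => rw [dualHom, lift_gen]; rfl
  | hadd b c hb hc => simp [hb, hc]
  | hmul b c hb hc => simp [hb, hc]

/-- The derivation `∂_a` of the nilHecke algebra: the unique `k`-linear derivation with
`∂_a x_i = x_i ^ 2` and `∂_a δ_i = a - (a + 1) x_i δ_i + (a - 1) x_{i + 1} δ_i`
(see `d_gen`, `d_mul`). -/
noncomputable def d (a : k) : Module.End k (NilHecke k n) :=
  TrivSqZeroExt.sndHom (NilHecke k n) (NilHecke k n) |>.restrictScalars k |>.comp
    (dualHom k a).toLinearMap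

lemma d_gen (a : k) (g : NilHeckeGen n) : d k a (gen k n g) = dGen k a g := by
  simp only [d, dualHom, LinearMap.comp_apply, AlgHom.toLinearMap_apply, lift_gen]
  rfl

lemma d_mul (a : k) (b c : NilHecke k n) : d k a (b * c) = d k a b * c + b * d k a c := by
  simp [d, dualHom_fst, TrivSqZeroExt.snd_mul, add_comm]

lemma d_algebraMap (a : k) (r : k) : d k a (algebraMap k (NilHecke k n) r) = 0 := by
  simp only [d, LinearMap.comp_apply, AlgHom.toLinearMap_apply, AlgHom.commutes]
  rfl

/-- The image in the nilHecke algebra of a word in the generators. -/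
def word (l : List (NilHeckeGen n)) : NilHecke k n := (l.map (gen k n)).prod

variable (n) in
/-- The homogeneous component of degree `i`: the span of all words of degree `i` in the
generators, where `deg x_i = 2` and `deg δ_i = -2`. -/
def grading (i : ℤ) : Submodule k (NilHecke k n) :=
  Submodule.span k {a | ∃ l : List (NilHeckeGen n), (l.map NilHeckeGen.deg).sum = i ∧ a = word k l}

lemma word_mem (l : List (NilHeckeGen n)) :
    word k l ∈ grading k n (l.map NilHeckeGen.deg).sum :=
  Submodule.subset_span ⟨l, rfl, rfl⟩

lemma one_mem : (1 : NilHecke k n) ∈ grading k n 0 := by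
  simpa [word] using word_mem k ([] : List (NilHeckeGen n))

lemma gen_mem (g : NilHeckeGen n) : gen k n g ∈ grading k n g.deg := by
  simpa [word] using word_mem k [g]

lemma mul_mem (i j : ℤ) (a b : NilHecke k n) (ha : a ∈ grading k n i) (hb : b ∈ grading k n j) :
    a * b ∈ grading k n (i + j) := by
  induction ha using Submodule.span_induction with
  | mem a ha =>
    obtain ⟨l, rfl, rfl⟩ := ha
    induction hb using Submodule.span_induction with
    | mem b hb =>
      obtain ⟨l', rfl, rfl⟩ := hb
      simpa [word] using word_mem k (l ++ l')
    | zero => simp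
    | add b c _ _ hb hc => rw [mul_add]; exact add_mem hb hc
    | smul r b _ hb => rw [mul_smul_comm]; exact Submodule.smul_mem _ r hb
  | zero => simp
  | add a c _ _ ha hc => rw [add_mul]; exact add_mem ha hc
  | smul r a _ ha => rw [smul_mul_assoc]; exact Submodule.smul_mem _ r ha

lemma x_mul_δ_mem (i j : ℕ) (hi : i < n) (hj : j + 1 < n) :
    X k i hi * δ k j hj ∈ grading k n 0 := by
  simpa [NilHeckeGen.deg] using mul_mem k _ _ _ _ (gen_mem k (.x i hi)) (gen_mem k (.δ j hj))

lemma dGen_mem (a : k) (g : NilHeckeGen n) : dGen k a g ∈ grading k n (g.deg + 2) := by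
  cases g with
  | x i hi =>
    rw [dGen, pow_two]
    exact mul_mem k _ _ _ _ (gen_mem k (.x i hi)) (gen_mem k (.x i hi))
  | δ i hi =>
    have e : (NilHeckeGen.δ i hi).deg + 2 = 0 := by simp [NilHeckeGen.deg]
    rw [e, dGen, Algebra.algebraMap_eq_smul_one]
    refine add_mem (sub_mem ?_ ?_) ?_ <;> refine Submodule.smul_mem _ _ ?_
    · exact one_mem k
    · exact x_mul_δ_mem k _ _ _ _
    · exact x_mul_δ_mem k _ _ _ _

lemma d_one (a : k) : d k a (1 : NilHecke k n) = 0 := by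
  simpa using d_algebraMap (n := n) k a 1

lemma d_mem (a : k) (i : ℤ) (b : NilHecke k n) (hb : b ∈ grading k n i) :
    d k a b ∈ grading k n (i + 2) := by
  induction hb using Submodule.span_induction with
  | mem b hb =>
    obtain ⟨l, rfl, rfl⟩ := hb
    induction l with
    | nil => simp [word, d_one]
    | cons g l ih =>
      have h : word k (g :: l) = gen k n g * word k l := by simp [word]
      rw [h, d_mul, d_gen, List.map_cons, List.sum_cons]
      refine add_mem ?_ ?_
      · have := mul_mem k _ _ _ _ (dGen_mem k a g) (word_mem k l)
        rwa [add_right_comm] at this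
      · have := mul_mem k _ _ _ _ (gen_mem k g) ih
        rwa [← add_assoc] at this
  | zero => simp
  | add b c _ _ hb hc => rw [map_add]; exact add_mem hb hc
  | smul r b _ hb => rw [map_smul]; exact Submodule.smul_mem _ r hb

/-- The values on generators of the homomorphism `b ↦ ∑_i b_i T ^ i`, with `b_i` the homogeneous
component of `b` of degree `i`. -/
noncomputable def degGen (g : NilHeckeGen n) : AddMonoidAlgebra (NilHecke k n) ℤ :=
  AddMonoidAlgebra.single g.deg (gen k n g)

lemma degGen_rel ⦃b c : FreeAlgebra k (NilHeckeGen n)⦄ (h : NilHeckeRel k b c) :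
    FreeAlgebra.lift k (degGen k) b = FreeAlgebra.lift k (degGen k) c := by
  cases h <;> simp only [map_mul, map_sub, map_zero, map_one, FreeAlgebra.lift_ι_apply, degGen,
    AddMonoidAlgebra.single_mul_single, NilHeckeGen.deg, AddMonoidAlgebra.one_def]
  case δ_sq i hi => rw [δ_sq, AddMonoidAlgebra.single_zero]
  case braid i hi hi' => rw [braid]
  case δ_comm i j hi hj hij => rw [δ_comm k i j hi hj hij]
  case x_δ_comm i j hi hj h h' => rw [x_δ_comm k i j hi hj h h', add_comm]
  case x_comm i j hi hj => rw [x_comm]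
  case x_δ i hi hi' =>
    rw [show (-2 + 2 : ℤ) = 2 + -2 from rfl, ← AddMonoidAlgebra.single_sub, x_δ]
    rfl
  case δ_x i hi hi' =>
    rw [show (-2 + 2 : ℤ) = 2 + -2 from rfl, ← AddMonoidAlgebra.single_sub, δ_x]
    rfl

/-- The homomorphism `b ↦ ∑_i b_i T ^ i`. -/
noncomputable def degHom : NilHecke k n →ₐ[k] AddMonoidAlgebra (NilHecke k n) ℤ :=
  lift k (degGen k) (degGen_rel k)

lemma degHom_of_mem (i : ℤ) (b : NilHecke k n) (hb : b ∈ grading k n i) :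
    degHom k b = AddMonoidAlgebra.single i b := by
  induction hb using Submodule.span_induction with
  | mem b hb =>
    obtain ⟨l, rfl, rfl⟩ := hb
    induction l with
    | nil =>
      simp only [word, List.map_nil, List.prod_nil, map_one]
      rfl
    | cons g l ih =>
      have h : word k (g :: l) = gen k n g * word k l := by simp [word]
      rw [h, map_mul, ih, degHom, lift_gen, degGen, AddMonoidAlgebra.single_mul_single,
        List.map_cons, List.sum_cons]
  | zero => simp
  | add b c _ _ hb hc => rw [map_add, hb, hc, AddMonoidAlgebra.single_add]
  | smul r b _ hb => rw [map_smul, hb, AddMonoidAlgebra.smul_single]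

lemma grading_isInternal : DirectSum.IsInternal (grading k n) := by
  classical
  constructor
  · intro v w hv
    have key : ∀ v : DirectSum ℤ fun i => grading k n i,
        ∀ j : ℤ, (degHom k (DirectSum.coeAddMonoidHom (grading k n) v)).coeff j =
          (v j : NilHecke k n) := by
      intro v j
      induction v using DirectSum.induction_on with
      | zero => simp
      | of i b =>
        rw [DirectSum.coeAddMonoidHom_of, degHom_of_mem k i (b : NilHecke k n) b.2,
          AddMonoidAlgebra.coeff_single, Finsupp.single_apply, DirectSum.coe_of_apply]
        split_ifs <;> rfl
      | add v w hv hw => simp [hv, hw]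
    ext j
    rw [← key, hv, key]
  · intro b
    induction b using NilHecke.induction with
    | hsc r =>
      rw [Algebra.algebraMap_eq_smul_one]
      exact ⟨DirectSum.of (fun i => grading k n i) 0 ⟨_, Submodule.smul_mem _ r (one_mem k)⟩,
        by rw [DirectSum.coeAddMonoidHom_of]⟩
    | hgen g =>
      exact ⟨DirectSum.of (fun i => grading k n i) g.deg ⟨_, gen_mem k g⟩,
        by rw [DirectSum.coeAddMonoidHom_of]⟩
    | hadd b c hb hc =>
      obtain ⟨v, rfl⟩ := hb
      obtain ⟨w, rfl⟩ := hc
      exact ⟨v + w, map_add _ _ _⟩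
    | hmul b c hb hc =>
      obtain ⟨v, rfl⟩ := hb
      obtain ⟨w, rfl⟩ := hc
      induction v using DirectSum.induction_on with
      | zero => exact ⟨0, by simp⟩
      | of i b =>
        induction w using DirectSum.induction_on with
        | zero => exact ⟨0, by simp⟩
        | of j c =>
          exact ⟨DirectSum.of (fun i => grading k n i) (i + j) ⟨_, mul_mem k _ _ _ _ b.2 c.2⟩,
            by simp only [DirectSum.coeAddMonoidHom_of]⟩
        | add v w hv hw =>
          obtain ⟨v', hv⟩ := hv
          obtain ⟨w', hw⟩ := hw
          exact ⟨v' + w', by rw [map_add, map_add, mul_add, hv, hw]⟩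
      | add v v' hv hw =>
        obtain ⟨v', hv⟩ := hv
        obtain ⟨w', hw⟩ := hw
        exact ⟨v' + w', by rw [map_add, map_add, add_mul, hv, hw]⟩

lemma d_d_d_δ (i : ℕ) (hi : i + 1 < n) : d k 0 (d k 0 (d k 0 (δ k i hi))) = 0 := by
  have h1 := (x_comm k (i + 1) i hi (by omega))
  simp only [d_gen, d_mul, dGen, map_add, map_sub, map_smul, map_neg, map_zero, pow_two, mul_add,
    add_mul, mul_sub, sub_mul, smul_mul_assoc, mul_smul_comm, mul_assoc, zero_mul, mul_zero, h1,
    mul_mul_of_eq h1, smul_add, smul_sub]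
  module

lemma d_d_δ (i : ℕ) (hi : i + 1 < n) :
    d k 0 (d k 0 (δ k i hi)) = (2 : k) • (X k i (by omega) * X k (i + 1) hi * δ k i hi) := by
  have h1 := (x_comm k (i + 1) i hi (by omega))
  simp only [d_gen, d_mul, dGen, map_add, map_sub, map_smul, map_neg, map_zero, pow_two, mul_add,
    add_mul, mul_sub, sub_mul, smul_mul_assoc, mul_smul_comm, mul_assoc, zero_mul, mul_zero, h1,
    mul_mul_of_eq h1, smul_add, smul_sub]
  module

lemma d_pow_x (a : k) (i : ℕ) (hi : i < n) (m : ℕ) :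
    (d k a ^ m) (X k i hi) = (m.factorial : k) • X k i hi ^ (m + 1) := by
  have h : ∀ m : ℕ, d k a (X k i hi ^ m) = (m : k) • X k i hi ^ (m + 1) := by
    intro m
    induction m with
    | zero => simp [d_one]
    | succ m ih =>
      rw [pow_succ, d_mul, ih, d_gen, dGen, smul_mul_assoc, ← pow_succ, ← pow_add,
        Nat.cast_succ, add_smul, one_smul]
  induction m with
  | zero => simp
  | succ m ih =>
    rw [pow_succ', Module.End.mul_apply, ih, map_smul, h, smul_smul, Nat.factorial_succ,
      Nat.cast_mul, mul_comm]

lemma d_pow_mul (p : ℕ) [Fact p.Prime] [CharP k p] (a : k) (b c : NilHecke k n) :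
    (d k a ^ p) (b * c) = (d k a ^ p) b * c + b * (d k a ^ p) c := by
  let D : Module.End k (NilHecke k n) := d k a
  let L : Module.End k (TensorProduct k (NilHecke k n) (NilHecke k n)) := D.rTensor _
  let R : Module.End k (TensorProduct k (NilHecke k n) (NilHecke k n)) := D.lTensor _
  have hLR : Commute L R := by
    change L ∘ₗ R = R ∘ₗ L
    simp [L, R]
  have h1 : ∀ m z, LinearMap.mul' k _ (((L + R) ^ m) z) = (D ^ m) (LinearMap.mul' k _ z) := by
    intro m
    induction m with
    | zero => simp
    | succ m ih =>
      intro z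
      rw [pow_succ, pow_succ, Module.End.mul_apply, ih, Module.End.mul_apply]
      congr 1
      induction z using TensorProduct.induction_on with
      | zero => simp
      | tmul b c => simp [L, R, D, d_mul]
      | add z w hz hw => rw [map_add, map_add, map_add, map_add, hz, hw]
  obtain ⟨r, hr⟩ := hLR.exists_add_pow_prime_eq (Fact.out : p.Prime)
  have hp : (p : Module.End k (TensorProduct k (NilHecke k n) (NilHecke k n))) = 0 := by
    rw [← map_natCast (algebraMap k _), CharP.cast_eq_zero, map_zero]
  have := h1 p (b ⊗ₜ c)
  rw [hr, hp, zero_mul, zero_mul, zero_mul, add_zero] at this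
  simpa only [L, R, D, LinearMap.rTensor_pow, LinearMap.lTensor_pow, LinearMap.add_apply, map_add,
    LinearMap.rTensor_tmul, LinearMap.lTensor_tmul, LinearMap.mul'_apply] using this.symm

lemma d_pow_char (p : ℕ) [Fact p.Prime] [CharP k p] :
    (d k 0 : Module.End k (NilHecke k n)) ^ p = 0 := by
  have hp : p.Prime := Fact.out
  ext b
  rw [LinearMap.zero_apply]
  induction b using NilHecke.induction with
  | hsc r =>
    obtain ⟨q, rfl⟩ : ∃ q, p = q + 1 := ⟨p - 1, by have := hp.pos; omega⟩
    rw [pow_succ, Module.End.mul_apply, d_algebraMap, map_zero]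
  | hgen g =>
    cases g with
    | x i hi =>
      rw [d_pow_x, (CharP.cast_eq_zero_iff k p _).2 (hp.dvd_factorial.2 le_rfl), zero_smul]
    | δ i hi =>
      obtain rfl | h3 := hp.two_le.eq_or_lt
      · rw [pow_two, Module.End.mul_apply, d_d_δ, show (2 : k) = 0 from CharP.cast_eq_zero k 2,
          zero_smul]
      · obtain ⟨q, rfl⟩ : ∃ q, p = q + 1 + 1 + 1 := ⟨p - 3, by omega⟩
        rw [pow_succ, pow_succ, pow_succ, Module.End.mul_apply, Module.End.mul_apply,
          Module.End.mul_apply, d_d_d_δ, map_zero]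
  | hadd b c hb hc => rw [map_add, hb, hc, add_zero]
  | hmul b c hb hc => rw [d_pow_mul, hb, hc, zero_mul, mul_zero, add_zero]

/-- The `p`-DG algebra `(NH_n, ∂_0)`, for `k` of characteristic `p`. -/
noncomputable def pdg (n : ℕ) (p : ℕ) [Fact p.Prime] [CharP k p] :
    PDGAlgebra k p (NilHecke k n) where
  grading := grading k n
  isInternal := grading_isInternal k
  one_mem := one_mem k
  mul_mem := mul_mem k
  d := d k 0
  d_mem := d_mem k 0
  d_pow := d_pow_char k p
  leibniz := d_mul k 0

end NilHecke

/-! ### Divided differences on polynomials -/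

/-! One module survives for every `n`: the polynomial ring `P = k[x_1, …, x_n]`, on which `x_i` acts
by multiplication, `δ_i` by the divided difference, and the differential is the derivation `D` with
`D x_i = x_i ^ 2`. The action respects the nilHecke relations (`polyGen_rel`). It respects the
differentials because `D (x_i - x_j) = (x_i - x_j)(x_i + x_j)`: the commutator of `D` with a divided
difference is then the operator by which `∂_0 δ_i` acts (`sqDerivation_divDiff`,
`sqDerivation_polyRep`). Since `P` is generated by `1` and `D 1 = 0`, the identity `∂_0 ^ p = 0`
carries over to `D ^ p = 0`.

The unit `1` is a nonzero cycle of degree `0`, and `P` vanishes in negative degrees. A null-homotopy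
`h` of the identity lowers degree by `2p - 2 > 0`, so `h 1 = 0`, and the homotopy formula at `1`
would give `1 = 0`. This argument is only `k`-linear, so `P` is not contractible even as a
`p`-complex. The forgetful functor to the homotopy category of `p`-complexes inverts
quasi-isomorphisms, hence factors through the derived category (`homotopic_forget_of_Q_map_eq`). The
identity and zero of `P` therefore remain distinct there, whereas in a category equivalent to the
zero category all parallel morphisms coincide. -/

namespace MvPolynomial

variable {k : Type u} [Field k] {σ : Type*}

lemma X_sub_X_ne_zero {i j : σ} (h : i ≠ j) : (X i - X j : MvPolynomial σ k) ≠ 0 :=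
  sub_ne_zero.2 fun e => h (X_injective e)

/-- The derivation of the polynomial algebra with `X i ↦ X i ^ 2`. -/
noncomputable abbrev sqDerivation (k : Type u) [Field k] (σ : Type*) :
    Derivation k (MvPolynomial σ k) (MvPolynomial σ k) :=
  mkDerivation k fun i => X i ^ 2

lemma sqDerivation_rename (e : σ → σ) (f : MvPolynomial σ k) :
    sqDerivation k σ (rename e f) = rename e (sqDerivation k σ f) := by
  induction f using MvPolynomial.induction_on with
  | C a => simp
  | add f g hf hg => simp only [map_add, hf, hg]
  | mul_X f l hf => simp [hf]

/-- The grading of the polynomial algebra with all variables in degree `2`. -/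
noncomputable abbrev evenGrading (k : Type u) [Field k] (σ : Type*) (i : ℤ) :
    Submodule k (MvPolynomial σ k) :=
  weightedHomogeneousSubmodule k (fun _ : σ => (2 : ℤ)) i

lemma evenGrading_isInternal : DirectSum.IsInternal (evenGrading k σ) := by
  let := weightedDecomposition k (fun _ : σ => (2 : ℤ))
  exact DirectSum.Decomposition.isInternal _

lemma mul_mem_evenGrading {i j : ℤ} {f g : MvPolynomial σ k} (hf : f ∈ evenGrading k σ i)
    (hg : g ∈ evenGrading k σ j) : f * g ∈ evenGrading k σ (i + j) :=
  IsWeightedHomogeneous.mul hf hg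

lemma X_mem_evenGrading (i : σ) : (X i : MvPolynomial σ k) ∈ evenGrading k σ 2 :=
  isWeightedHomogeneous_X k _ i

lemma C_mem_evenGrading (r : k) : (C r : MvPolynomial σ k) ∈ evenGrading k σ 0 :=
  isWeightedHomogeneous_C _ r

/-- This is what will kill any homotopy on the unit: its value there lies in degree `2 - 2p`. -/
lemma evenGrading_eq_bot_of_neg {i : ℤ} (hi : i < 0) : evenGrading k σ i = ⊥ := by
  rw [eq_bot_iff]
  intro f hf
  rw [Submodule.mem_bot]
  ext m
  rw [coeff_zero]
  refine IsWeightedHomogeneous.coeff_eq_zero hf m fun e => ?_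
  have : 0 ≤ Finsupp.weight (fun _ : σ => (2 : ℤ)) m := by
    rw [Finsupp.weight_apply, Finsupp.sum]
    exact Finset.sum_nonneg fun _ _ => by positivity
  omega

/-- To check that a linear map has degree `e`, it suffices to check it on constants, and that it
is inherited by products with a variable. -/
lemma map_mem_evenGrading_of_mul_X (L : Module.End k (MvPolynomial σ k)) (e : ℤ)
    (hC : ∀ r, L (C r) ∈ evenGrading k σ (0 + e))
    (hX : ∀ (f : MvPolynomial σ k) (l : σ) (i : ℤ), f ∈ evenGrading k σ i →
      L f ∈ evenGrading k σ (i + e) → L (f * X l) ∈ evenGrading k σ (i + 2 + e))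
    (i : ℤ) (f : MvPolynomial σ k) (hf : f ∈ evenGrading k σ i) :
    L f ∈ evenGrading k σ (i + e) := by
  -- The degree is left existential so that the induction can build monomials one variable at a
  -- time; a nonzero coefficient forces it to be `i` afterwards.
  have key : ∀ m r, ∃ j, monomial m r ∈ evenGrading k σ j ∧
      L (monomial m r) ∈ evenGrading k σ (j + e) :=
    induction_on_monomial (fun r => ⟨0, C_mem_evenGrading r, hC r⟩)
      fun f l ⟨j, h1, h2⟩ => ⟨j + 2, mul_mem_evenGrading h1 (X_mem_evenGrading l), hX f l j h1 h2⟩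
  classical
  rw [f.as_sum, map_sum]
  refine Submodule.sum_mem _ fun m hm => ?_
  obtain ⟨j, h1, h2⟩ := key m (coeff m f)
  have hj : j = i := by
    rw [mem_support_iff] at hm
    rw [← hf hm]
    exact (h1 (d := m) (by rwa [coeff_monomial, if_pos rfl])).symm
  rwa [← hj]

lemma sqDerivation_mem_evenGrading (d : ℤ) (f : MvPolynomial σ k)
    (hf : f ∈ evenGrading k σ d) : sqDerivation k σ f ∈ evenGrading k σ (d + 2) := by
  refine map_mem_evenGrading_of_mul_X (sqDerivation k σ).toLinearMap 2 (fun r => ?_)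
    (fun f l d hf hL => ?_) d f hf
  · simp
  · change sqDerivation k σ f ∈ _ at hL
    change sqDerivation k σ (f * X l) ∈ _
    rw [Derivation.leibniz, mkDerivation_X, smul_eq_mul, smul_eq_mul, pow_two]
    refine add_mem ?_ ?_
    · have := mul_mem_evenGrading hf
        (mul_mem_evenGrading (X_mem_evenGrading (k := k) l) (X_mem_evenGrading l))
      rwa [show d + 2 + 2 = d + (2 + 2) by ring]
    · rw [show d + 2 + 2 = 2 + (d + 2) by ring]
      exact mul_mem_evenGrading (X_mem_evenGrading _) hL

/-! ### Variable swaps and divided differences -/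

variable [DecidableEq σ]

/-- The automorphism of the polynomial algebra exchanging two variables. -/
noncomputable abbrev swapVars (k : Type u) [Field k] {σ : Type*} [DecidableEq σ] (i j : σ) :
    MvPolynomial σ k →ₐ[k] MvPolynomial σ k :=
  rename (Equiv.swap i j)

lemma swapVars_swapVars (i j : σ) (f : MvPolynomial σ k) :
    swapVars k i j (swapVars k i j f) = f := by
  rw [rename_rename]
  have : (Equiv.swap i j : σ → σ) ∘ Equiv.swap i j = id := by
    ext; simp
  rw [this, rename_id_apply]

/-- Both composites relabel by the transposition of `i` and `l`. -/
lemma swapVars_braid {i j l : σ} (hij : i ≠ j) (hjl : j ≠ l) (hil : i ≠ l)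
    (f : MvPolynomial σ k) :
    swapVars k i j (swapVars k j l (swapVars k i j f)) =
      swapVars k j l (swapVars k i j (swapVars k j l f)) := by
  simp only [rename_rename]
  congr 2
  ext x
  simp only [Function.comp_apply, Equiv.swap_apply_def]
  grind

lemma swapVars_comm {i j l m : σ} (hil : i ≠ l) (him : i ≠ m) (hjl : j ≠ l) (hjm : j ≠ m)
    (f : MvPolynomial σ k) :
    swapVars k i j (swapVars k l m f) = swapVars k l m (swapVars k i j f) := by
  simp only [rename_rename]
  congr 2
  ext x
  simp only [Function.comp_apply, Equiv.swap_apply_def]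
  grind

/-- The operator `f ↦ f - s f` satisfies a twisted Leibniz rule, so divisibility passes to products.
On a variable it takes one of the values `0` and `±(X i - X j)`. -/
lemma X_sub_X_dvd_sub_swapVars (i j : σ) (f : MvPolynomial σ k) :
    (X i - X j : MvPolynomial σ k) ∣ f - swapVars k i j f := by
  induction f using MvPolynomial.induction_on with
  | C a => simp
  | add f g hf hg =>
    rw [map_add, add_sub_add_comm]
    exact dvd_add hf hg
  | mul_X f l hf =>
    have h : (X i - X j : MvPolynomial σ k) ∣ X l - swapVars k i j (X l) := by
      rw [rename_X, Equiv.swap_apply_def]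
      split_ifs with h1 h2
      · rw [h1]
      · rw [h2, ← neg_sub, neg_dvd]
      · simp
    have e : f * X l - swapVars k i j (f * X l) =
        (f - swapVars k i j f) * X l + swapVars k i j f * (X l - swapVars k i j (X l)) := by
      rw [map_mul]; ring
    rw [e]
    exact dvd_add (hf.mul_right _) (h.mul_left _)

/-- The divided difference operator `f ↦ (f - s f) / (X i - X j)`, where `s` exchanges the
variables `X i` and `X j`. -/
noncomputable def divDiff {i j : σ} (h : i ≠ j) : Module.End k (MvPolynomial σ k) where
  toFun f := (X_sub_X_dvd_sub_swapVars i j f).choose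
  map_add' f g := by
    -- The chosen quotient is unique, since polynomials form a domain; linearity can thus be tested
    -- after multiplying by `X i - X j`.
    apply mul_left_cancel₀ (X_sub_X_ne_zero (k := k) h)
    rw [mul_add, ← (X_sub_X_dvd_sub_swapVars i j f).choose_spec,
      ← (X_sub_X_dvd_sub_swapVars i j g).choose_spec,
      ← (X_sub_X_dvd_sub_swapVars i j (f + g)).choose_spec, map_add]
    ring
  map_smul' r f := by
    apply mul_left_cancel₀ (X_sub_X_ne_zero (k := k) h)
    rw [RingHom.id_apply, mul_smul_comm, ← (X_sub_X_dvd_sub_swapVars i j f).choose_spec,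
      ← (X_sub_X_dvd_sub_swapVars i j (r • f)).choose_spec, map_smul, smul_sub]

lemma X_sub_X_mul_divDiff {i j : σ} (h : i ≠ j) (f : MvPolynomial σ k) :
    (X i - X j) * divDiff h f = f - swapVars k i j f :=
  (X_sub_X_dvd_sub_swapVars i j f).choose_spec.symm

/-- Uniqueness of the quotient: this turns identities between divided differences into polynomial
identities without denominators. -/
lemma divDiff_eq_of {i j : σ} (h : i ≠ j) {f g : MvPolynomial σ k}
    (e : (X i - X j) * g = f - swapVars k i j f) : divDiff h f = g :=
  mul_left_cancel₀ (X_sub_X_ne_zero (k := k) h) (by rw [X_sub_X_mul_divDiff, e])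

/-- The twisted Leibniz rule. With a variable as first factor it yields the relations between `x`
and `δ`. -/
lemma divDiff_mul {i j : σ} (h : i ≠ j) (f g : MvPolynomial σ k) :
    divDiff h (f * g) = divDiff h f * g + swapVars k i j f * divDiff h g := by
  apply divDiff_eq_of
  have hf := X_sub_X_mul_divDiff h f
  have hg := X_sub_X_mul_divDiff h g
  rw [map_mul]
  linear_combination g * hf + swapVars k i j f * hg

lemma divDiff_X_left {i j : σ} (h : i ≠ j) : divDiff h (X i : MvPolynomial σ k) = 1 := by
  apply divDiff_eq_of
  simp

lemma divDiff_X_right {i j : σ} (h : i ≠ j) : divDiff h (X j : MvPolynomial σ k) = -1 := by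
  apply divDiff_eq_of
  simp

lemma divDiff_X_of_ne {i j l : σ} (h : i ≠ j) (hi : l ≠ i) (hj : l ≠ j) :
    divDiff h (X l : MvPolynomial σ k) = 0 := by
  apply divDiff_eq_of
  simp [Equiv.swap_apply_of_ne_of_ne hi hj]

lemma divDiff_C {i j : σ} (h : i ≠ j) (r : k) : divDiff h (C r : MvPolynomial σ k) = 0 := by
  apply divDiff_eq_of
  simp

/-- The swap changes the sign of both `f - s f` and `X i - X j`. -/
lemma swapVars_divDiff {i j : σ} (h : i ≠ j) (f : MvPolynomial σ k) :
    swapVars k i j (divDiff h f) = divDiff h f := by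
  have e := congrArg (swapVars k i j) (X_sub_X_mul_divDiff h f)
  rw [map_mul, map_sub, map_sub, swapVars_swapVars, rename_X, rename_X, Equiv.swap_apply_left,
    Equiv.swap_apply_right] at e
  apply mul_left_cancel₀ (X_sub_X_ne_zero (k := k) h)
  linear_combination -e - X_sub_X_mul_divDiff h f

lemma divDiff_divDiff_self {i j : σ} (h : i ≠ j) (f : MvPolynomial σ k) :
    divDiff h (divDiff h f) = 0 := by
  apply divDiff_eq_of
  rw [swapVars_divDiff]
  ring

/-- Each swap fixes the denominator of the other operator. After clearing both denominators, the two
sides are the same alternating sum over the group generated by the two commuting swaps. -/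
lemma divDiff_comm {i j l m : σ} (h : i ≠ j) (h' : l ≠ m) (hil : i ≠ l) (him : i ≠ m)
    (hjl : j ≠ l) (hjm : j ≠ m) (f : MvPolynomial σ k) :
    divDiff h (divDiff h' f) = divDiff h' (divDiff h f) := by
  apply divDiff_eq_of
  apply mul_left_cancel₀ (X_sub_X_ne_zero (k := k) h')
  have h1 := X_sub_X_mul_divDiff h' (divDiff h f)
  have h2 := X_sub_X_mul_divDiff h' f
  have h3 := X_sub_X_mul_divDiff h f
  have h4 := congrArg (swapVars k l m) h3
  have h5 := congrArg (swapVars k i j) h2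
  simp only [map_mul, map_sub, rename_X, Equiv.swap_apply_of_ne_of_ne hil him,
    Equiv.swap_apply_of_ne_of_ne hjl hjm, Equiv.swap_apply_of_ne_of_ne hil.symm hjl.symm,
    Equiv.swap_apply_of_ne_of_ne him.symm hjm.symm] at h4 h5
  rw [swapVars_comm hil him hjl hjm] at h5
  linear_combination (X i - X j) * h1 + h3 - h4 - h2 + h5

/-- The product of three divided differences, as the antisymmetrization over `S₃` divided by the
Vandermonde product. -/
lemma mul_divDiff_divDiff_divDiff {i j l : σ} (h : i ≠ j) (h' : j ≠ l) (hil : i ≠ l)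
    (f : MvPolynomial σ k) :
    (X i - X j) * (X j - X l) * (X i - X l) * divDiff h (divDiff h' (divDiff h f)) =
      f - swapVars k i j f - swapVars k j l f + swapVars k j l (swapVars k i j f) +
        swapVars k i j (swapVars k j l f) -
        swapVars k i j (swapVars k j l (swapVars k i j f)) := by
  have h1 := X_sub_X_mul_divDiff h f
  have h2 := X_sub_X_mul_divDiff h' (divDiff h f)
  have h3 := X_sub_X_mul_divDiff h (divDiff h' (divDiff h f))
  have h4 := congrArg (swapVars k j l) h1
  have h5 := congrArg (swapVars k i j) h4
  have h6 := congrArg (swapVars k i j) h2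
  simp only [map_mul, map_sub, rename_X, Equiv.swap_apply_left, Equiv.swap_apply_right,
    Equiv.swap_apply_of_ne_of_ne h hil, Equiv.swap_apply_of_ne_of_ne hil.symm h'.symm,
    swapVars_divDiff] at h4 h5 h6
  -- Since `(X i - X l) - (X j - X l) = X i - X j`, the two occurrences of `divDiff h f` merge into
  -- the left side of `h1`; the two transformed occurrences are the left sides of `h4` and `h5`.
  linear_combination (X j - X l) * (X i - X l) * h3 + (X i - X l) * h2 - (X j - X l) * h6
    + h1 - h4 + h5

lemma mul_divDiff_divDiff_divDiff' {i j l : σ} (h : i ≠ j) (h' : j ≠ l) (hil : i ≠ l)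
    (f : MvPolynomial σ k) :
    (X i - X j) * (X j - X l) * (X i - X l) * divDiff h' (divDiff h (divDiff h' f)) =
      f - swapVars k i j f - swapVars k j l f + swapVars k j l (swapVars k i j f) +
        swapVars k i j (swapVars k j l f) -
        swapVars k j l (swapVars k i j (swapVars k j l f)) := by
  have h1 := X_sub_X_mul_divDiff h' f
  have h2 := X_sub_X_mul_divDiff h (divDiff h' f)
  have h3 := X_sub_X_mul_divDiff h' (divDiff h (divDiff h' f))
  have h4 := congrArg (swapVars k i j) h1
  have h5 := congrArg (swapVars k j l) h4
  have h6 := congrArg (swapVars k j l) h2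
  simp only [map_mul, map_sub, rename_X, Equiv.swap_apply_left, Equiv.swap_apply_right,
    Equiv.swap_apply_of_ne_of_ne h hil, Equiv.swap_apply_of_ne_of_ne hil.symm h'.symm,
    swapVars_divDiff] at h4 h5 h6
  linear_combination (X i - X j) * (X i - X l) * h3 + (X i - X l) * h2 - (X i - X j) * h6
    + h1 - h4 + h5

/-- The two antisymmetrizations differ only in the reduced word chosen for the longest element of
`S₃`. -/
lemma divDiff_braid {i j l : σ} (h : i ≠ j) (h' : j ≠ l) (hil : i ≠ l) (f : MvPolynomial σ k) :
    divDiff h (divDiff h' (divDiff h f)) = divDiff h' (divDiff h (divDiff h' f)) := by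
  apply mul_left_cancel₀ (mul_ne_zero (mul_ne_zero (X_sub_X_ne_zero (k := k) h)
    (X_sub_X_ne_zero h')) (X_sub_X_ne_zero hil))
  rw [mul_divDiff_divDiff_divDiff h h' hil, mul_divDiff_divDiff_divDiff' h h' hil,
    swapVars_braid h h' hil]

/-- Differentiate `(X i - X j) * divDiff h f = f - s f`: the derivation commutes with `s`, and `X i
^ 2 - X j ^ 2 = (X i - X j)(X i + X j)` produces the correction term. That term matches `∂_0 δ_i`.
-/
lemma sqDerivation_divDiff {i j : σ} (h : i ≠ j) (f : MvPolynomial σ k) :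
    sqDerivation k σ (divDiff h f) =
      -((X i + X j) * divDiff h f) + divDiff h (sqDerivation k σ f) := by
  have h1 := congrArg (sqDerivation k σ) (X_sub_X_mul_divDiff h f)
  have h2 := X_sub_X_mul_divDiff h (sqDerivation k σ f)
  rw [Derivation.leibniz, map_sub, map_sub, sqDerivation_rename, mkDerivation_X, mkDerivation_X,
    smul_eq_mul, smul_eq_mul] at h1
  apply mul_left_cancel₀ (X_sub_X_ne_zero (k := k) h)
  linear_combination h1 - h2

lemma divDiff_mem_evenGrading {i j : σ} (h : i ≠ j) (d : ℤ) (f : MvPolynomial σ k)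
    (hf : f ∈ evenGrading k σ d) : divDiff h f ∈ evenGrading k σ (d + -2) := by
  refine map_mem_evenGrading_of_mul_X (divDiff h) (-2) (fun r => ?_) (fun f l d hf hL => ?_) d f hf
  · rw [divDiff_C]
    exact zero_mem _
  -- With the variable as first factor the swap falls on it alone, so the induction hypothesis on
  -- `f` applies as it stands.
  · rw [mul_comm, divDiff_mul]
    refine add_mem ?_ ?_
    · have hc : ∃ r : k, divDiff h (X l : MvPolynomial σ k) = C r := by
        by_cases hi : l = i
        · subst hi
          exact ⟨1, by rw [divDiff_X_left, C_1]⟩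
        · by_cases hj : l = j
          · subst hj
            exact ⟨-1, by rw [divDiff_X_right, C_neg, C_1]⟩
          · exact ⟨0, by rw [divDiff_X_of_ne h hi hj, C_0]⟩
      obtain ⟨r, hr⟩ := hc
      rw [hr]
      have := mul_mem_evenGrading (C_mem_evenGrading (σ := σ) r) hf
      rwa [show d + 2 + -2 = 0 + d by ring]
    · rw [rename_X, show d + 2 + -2 = 2 + (d + -2) by ring]
      exact mul_mem_evenGrading (X_mem_evenGrading _) hL

end MvPolynomial

/-! ### The polynomial module over the nilHecke algebra -/

namespace NilHecke

open MvPolynomial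

variable (k : Type u) [Field k] {n : ℕ}

/-- The action of the generators on polynomials: `x_i` by multiplication, `δ_i` by the divided
difference operator. -/
noncomputable def polyGen : NilHeckeGen n → Module.End k (MvPolynomial (Fin n) k)
  | .x i hi => LinearMap.mulLeft k (MvPolynomial.X ⟨i, hi⟩)
  | .δ i hi => divDiff (i := (⟨i, by omega⟩ : Fin n)) (j := ⟨i + 1, hi⟩) (by simp)

/-- The relations mixing `x` and `δ` are the twisted Leibniz rule for a variable times `f`. -/
lemma polyGen_rel ⦃b c : FreeAlgebra k (NilHeckeGen n)⦄ (h : NilHeckeRel k b c) :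
    FreeAlgebra.lift k (polyGen k) b = FreeAlgebra.lift k (polyGen k) c := by
  refine LinearMap.ext fun f => ?_
  cases h <;> simp only [map_mul, map_sub, map_zero, map_one, FreeAlgebra.lift_ι_apply, polyGen,
    Module.End.mul_apply, LinearMap.sub_apply, LinearMap.zero_apply, Module.End.one_apply,
    LinearMap.mulLeft_apply]
  case δ_sq i hi => exact divDiff_divDiff_self _ f
  case braid i hi hi' => exact divDiff_braid _ _ (by simp; omega) f
  case δ_comm i j hi hj hij =>
    apply divDiff_comm <;> simp only [ne_eq, Fin.mk.injEq] <;> omega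
  case x_δ_comm i j hi hj h h' =>
    rw [divDiff_mul, divDiff_X_of_ne, rename_X, Equiv.swap_apply_of_ne_of_ne, zero_mul, zero_add]
    all_goals simp only [ne_eq, Fin.mk.injEq]; omega
  case x_comm i j hi hj => ring
  case x_δ i hi hi' =>
    rw [divDiff_mul, divDiff_X_right, rename_X, Equiv.swap_apply_right]
    ring
  case δ_x i hi hi' =>
    rw [divDiff_mul, divDiff_X_left, rename_X, Equiv.swap_apply_left]
    ring

/-- The polynomial representation of the nilHecke algebra. -/
noncomputable def polyRep : NilHecke k n →ₐ[k] Module.End k (MvPolynomial (Fin n) k) :=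
  lift k (polyGen k) (polyGen_rel k)

lemma polyRep_gen (g : NilHeckeGen n) : polyRep k (gen k n g) = polyGen k g :=
  lift_gen k _ _ g

/-- The compatibility is inherited by sums and products of operators, because `d k 0` is a
derivation, so only the generators carry content. -/
lemma sqDerivation_polyRep (a : NilHecke k n) (f : MvPolynomial (Fin n) k) :
    sqDerivation k (Fin n) (polyRep k a f) =
      polyRep k (d k 0 a) f + polyRep k a (sqDerivation k (Fin n) f) := by
  induction a using NilHecke.induction generalizing f with
  | hsc r => simp [d_algebraMap]
  | hgen g =>
    cases g with
    | x i hi =>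
      rw [d_gen, dGen, map_pow, polyRep_gen, polyGen, pow_two]
      simp only [Module.End.mul_apply, LinearMap.mulLeft_apply, Derivation.leibniz,
        mkDerivation_X, smul_eq_mul]
      ring
    | δ i hi =>
      have e : d k 0 (gen k n (.δ i hi)) =
          -(X k i (by omega) * δ k i hi + X k (i + 1) hi * δ k i hi) := by
        rw [d_gen, dGen, map_zero]
        module
      rw [e, polyRep_gen, polyGen, sqDerivation_divDiff]
      simp only [map_add, map_neg, map_mul, polyRep_gen, polyGen, LinearMap.add_apply,
        LinearMap.neg_apply, Module.End.mul_apply, LinearMap.mulLeft_apply]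
      ring
  | hadd a b ha hb =>
    simp only [map_add, LinearMap.add_apply, ha, hb]
    abel
  | hmul a b ha hb =>
    simp only [map_add, d_mul, map_mul, LinearMap.add_apply, Module.End.mul_apply, ha, hb]
    abel

lemma polyRep_mem (i j : ℤ) (a : NilHecke k n) (f : MvPolynomial (Fin n) k)
    (ha : a ∈ grading k n i) (hf : f ∈ evenGrading k (Fin n) j) :
    polyRep k a f ∈ evenGrading k (Fin n) (i + j) := by
  induction ha using Submodule.span_induction with
  | mem a ha =>
    obtain ⟨l, rfl, rfl⟩ := ha
    induction l with
    | nil => simpa [word] using hf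
    | cons g l ih =>
      have h : word k (g :: l) = gen k n g * word k l := by simp [word]
      rw [h, map_mul, Module.End.mul_apply, polyRep_gen, List.map_cons, List.sum_cons]
      cases g with
      | x i hi =>
        rw [add_assoc]
        exact mul_mem_evenGrading (X_mem_evenGrading _) ih
      | δ i hi =>
        have := divDiff_mem_evenGrading (i := (⟨i, by omega⟩ : Fin n)) (j := ⟨i + 1, hi⟩)
          (by simp) _ _ ih
        rwa [add_assoc, add_comm]
  | zero => simp
  | add a b _ _ ha hb => rw [map_add]; exact add_mem ha hb
  | smul r a _ ha => rw [map_smul]; exact Submodule.smul_mem _ r ha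

/-- The module is cyclic on the unit, which lets properties of `∂_0` descend from the algebra to
polynomials. -/
lemma exists_polyRep_one (f : MvPolynomial (Fin n) k) : ∃ a : NilHecke k n, polyRep k a 1 = f := by
  induction f using MvPolynomial.induction_on with
  | C r => exact ⟨algebraMap k _ r, by simp [MvPolynomial.smul_eq_C_mul]⟩
  | add f g hf hg =>
    obtain ⟨a, rfl⟩ := hf
    obtain ⟨b, rfl⟩ := hg
    exact ⟨a + b, by rw [map_add, LinearMap.add_apply]⟩
  | mul_X f i hf =>
    obtain ⟨a, rfl⟩ := hf
    exact ⟨X k i i.2 * a, by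
      rw [map_mul, Module.End.mul_apply, polyRep_gen, mul_comm]; rfl⟩

lemma sqDerivation_pow_polyRep_one (a : NilHecke k n) (m : ℕ) :
    ((sqDerivation k (Fin n)).toLinearMap ^ m) (polyRep k a 1) = polyRep k ((d k 0 ^ m) a) 1 := by
  induction m with
  | zero => simp
  | succ m ih =>
    rw [pow_succ', pow_succ', Module.End.mul_apply, Module.End.mul_apply, ih,
      Derivation.coeFn_coe, sqDerivation_polyRep, Derivation.map_one_eq_zero, map_zero, add_zero]

/-- The polynomial `p`-DG module over `(NH_n, ∂_0)`, on which the differential is the derivation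
with `x_i ↦ x_i ^ 2`. -/
noncomputable def polyModule (n : ℕ) (p : ℕ) [Fact p.Prime] [CharP k p] :
    PDGModule (pdg k n p) where
  carrier := MvPolynomial (Fin n) k
  grading := evenGrading k (Fin n)
  isInternal := evenGrading_isInternal
  d := (sqDerivation k (Fin n)).toLinearMap
  d_mem := sqDerivation_mem_evenGrading
  d_pow := by
    -- Writing `f = a · 1` with `1` a cycle reduces the claim to `∂_0 ^ p a = 0`.
    refine LinearMap.ext fun f => ?_
    obtain ⟨a, rfl⟩ := exists_polyRep_one k f
    rw [sqDerivation_pow_polyRep_one, d_pow_char, LinearMap.zero_apply, map_zero]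
    rfl
  moduleA := Module.compHom _ (polyRep k).toRingHom
  isScalarTower :=
    letI : Module (NilHecke k n) (MvPolynomial (Fin n) k) :=
      Module.compHom _ (polyRep k).toRingHom
    ⟨fun r a f => by
      change polyRep k (r • a) f = r • polyRep k a f
      rw [map_smul, LinearMap.smul_apply]⟩
  smul_mem i j a f := polyRep_mem k i j a f
  leibniz := sqDerivation_polyRep k

end NilHecke

/-! ### Nonvanishing of the derived category -/

/-! ### Homotopy as a congruence -/

namespace PComplex

variable {k : Type u} [Field k] {p : ℕ}

/-- The quotient category identifies morphisms under the generated congruence. Since homotopy is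
already one, equal classes give an actual homotopy `h`. -/
instance : Congruence (Homotopic (k := k) (p := p)) where
  equivalence {M N} :=
    { refl f := ⟨0, fun i m _ => zero_mem _, fun m => by simp⟩
      symm := by
        rintro f g ⟨h, hd, hh⟩
        refine ⟨-h, fun i m hm => neg_mem (hd i m hm), fun m => ?_⟩
        rw [← neg_sub, hh, ← Finset.sum_neg_distrib]
        simp
      trans := by
        rintro f g e ⟨h, hd, hh⟩ ⟨h', hd', hh'⟩
        refine ⟨h + h', fun i m hm => add_mem (hd i m hm) (hd' i m hm), fun m => ?_⟩
        rw [← sub_add_sub_cancel, hh, hh', ← Finset.sum_add_distrib]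
        simp }
  comp_left {M N P} f g g' := by
    rintro ⟨h, hd, hh⟩
    refine ⟨h ∘ₗ f.toLinearMap, fun i m hm => hd i _ (f.map_mem i m hm), fun m => ?_⟩
    have hf : ∀ (i : ℕ) m, f.toLinearMap ((M.d ^ i) m) = (N.d ^ i) (f.toLinearMap m) := by
      intro i
      induction i with
      | zero => simp
      | succ i ih => intro m; rw [pow_succ', pow_succ', Module.End.mul_apply, f.map_d, ih]; rfl
    simp only [LinearMap.comp_apply, hf]
    exact hh _
  comp_right {M N P} f f' g := by
    rintro ⟨h, hd, hh⟩
    refine ⟨g.toLinearMap ∘ₗ h, fun i m hm => g.map_mem _ _ (hd i m hm), fun m => ?_⟩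
    have hg : ∀ (i : ℕ) m, g.toLinearMap ((N.d ^ i) m) = (P.d ^ i) (g.toLinearMap m) := by
      intro i
      induction i with
      | zero => simp
      | succ i ih => intro m; rw [pow_succ', pow_succ', Module.End.mul_apply, g.map_d, ih]; rfl
    simp only [LinearMap.comp_apply, ← hg, ← map_sum, ← hh]
    exact (map_sub g.toLinearMap (f.toLinearMap m) (f'.toLinearMap m)).symm

end PComplex

/-! ### Detecting nonzero objects on underlying `p`-complexes -/

namespace PDGModule

variable {k : Type u} [Field k] {p : ℕ} {A : Type u} [Ring A] [Algebra k A]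
  {𝒜 : PDGAlgebra k p A}

/-- Morphisms of `p`-DG modules which agree in the derived category are homotopic as morphisms of
`p`-complexes. -/
lemma homotopic_forget_of_Q_map_eq {M N : PDGModule 𝒜} {f g : M ⟶ N}
    (h : (quasiIso 𝒜).Q.map ((Quotient.functor Homotopic).map f) =
      (quasiIso 𝒜).Q.map ((Quotient.functor Homotopic).map g)) :
    PComplex.Homotopic ((forget 𝒜).map f) ((forget 𝒜).map g) := by
  -- Quasi-isomorphisms are by definition the morphisms that `homotopyForget` inverts, so this
  -- functor factors through the localization.
  have hinv : (quasiIso 𝒜).IsInvertedBy (homotopyForget 𝒜) := fun _ _ _ hf => hf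
  have hfac := Localization.Construction.fac (homotopyForget 𝒜) hinv
  have key : ∀ {f g : (Quotient.functor Homotopic).obj M ⟶ (Quotient.functor Homotopic).obj N},
      (quasiIso 𝒜).Q.map f = (quasiIso 𝒜).Q.map g →
        (homotopyForget 𝒜).map f = (homotopyForget 𝒜).map g := by
    intro f g h
    rw [Functor.congr_hom hfac.symm, Functor.congr_hom hfac.symm, Functor.comp_map,
      Functor.comp_map, h]
  exact (Quotient.functor_map_eq_iff _ _ _).1 (key h)

/-- The zero endomorphism of a `p`-DG module. -/
def zeroEnd (M : PDGModule 𝒜) : M ⟶ M :=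
  (⟨0, fun _ _ _ => zero_mem _, fun _ => by simp⟩ : Hom M M)

/-- A `p`-DG module with a nonzero cycle of degree `0` and with nothing in degree `2 - 2p` is not
zero in the derived category. -/
lemma not_equivalence_punit_of_cycle (M : PDGModule 𝒜) (hp : p ≠ 0) (m : M.carrier) (hm : m ≠ 0)
    (hm0 : m ∈ M.grading 0) (hd : M.d m = 0) (hneg : M.grading (2 - 2 * (p : ℤ)) = ⊥) :
    ¬ Nonempty (PDGDerivedCategory 𝒜 ≌ Discrete PUnit.{1}) := by
  rintro ⟨e⟩
  obtain ⟨h, hdeg, hh⟩ : ∃ h : M.carrier →ₗ[k] M.carrier,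
      (∀ (i : ℤ) (m : M.carrier), m ∈ M.grading i → h m ∈ M.grading (i + (2 - 2 * (p : ℤ)))) ∧
      ∀ m : M.carrier, m - 0 = ∑ i ∈ Finset.range p, (M.d ^ (p - 1 - i)) (h ((M.d ^ i) m)) :=
    homotopic_forget_of_Q_map_eq (f := 𝟙 M) (g := zeroEnd M)
      -- An equivalence is faithful, and `Discrete PUnit` has at most one morphism between two
      -- objects.
      (e.functor.map_injective (Subsingleton.elim _ _))
  have h0 : h m = 0 := by
    have := hdeg 0 m hm0
    rw [zero_add] at this
    exact (Submodule.mem_bot k).1 (hneg ▸ this)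
  apply hm
  have := hh m
  -- The terms with `i > 0` contain `d m = 0`; the term `i = 0` is `d ^ (p - 1)` applied to `h m =
  -- 0`.
  rw [Finset.sum_eq_single_of_mem 0 (Finset.mem_range.2 (Nat.pos_of_ne_zero hp))] at this
  · rw [pow_zero, Module.End.one_apply, h0, map_zero] at this
    rwa [sub_zero] at this
  · intro i _ hi
    obtain ⟨i, rfl⟩ := Nat.exists_eq_succ_of_ne_zero hi
    have hz : (M.d ^ (i + 1)) m = 0 := by
      rw [pow_succ, Module.End.mul_apply, hd, map_zero]
    rw [hz, map_zero, map_zero]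

end PDGModule

theorem mainTheorem8 (p : ℕ) [Fact p.Prime] (k : Type u) [Field k] [CharP k p] (n : ℕ) :
    ¬ Nonempty (PDGDerivedCategory (NilHecke.pdg k n p) ≌ Discrete PUnit.{1}) := by
  have hp : p.Prime := Fact.out
  refine PDGModule.not_equivalence_punit_of_cycle (NilHecke.polyModule k n p) hp.ne_zero
    (show MvPolynomial (Fin n) k from 1) (one_ne_zero (α := MvPolynomial (Fin n) k))
    (MvPolynomial.isWeightedHomogeneous_one k _)
    (MvPolynomial.sqDerivation k (Fin n)).map_one_eq_zero
    (MvPolynomial.evenGrading_eq_bot_of_neg ?_)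
  -- The degree `2 - 2p` is negative because `p ≥ 2`.
  have := hp.two_le
  omega
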